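/- Let $d,m\ge 0$ be integers, $\epsilon>0$, $\sigma\ge 0$. For a Borel probability measure $\mu$ on $\mathbb R^d$ let $\|\mu\|_{\mathcal G}$ be the infimum of all $s>0$ such that $\int e^{\langle x,v\rangle^2/s^2}\,d\mu(x)\le 2$ for every unit vector $v\in\mathbb R^d$ ($\infty$ if there is no such $s$); $\mu$ is called $\sigma$-subgaussian if $\|\mu\|_{\mathcal G}\le\sigma$. Let $\mathcal P_2(\mathbb R^d)$ be the set of Borel probability measures on $\mathbb R^d$ with finite second moment, let $$OT_2^\epsilon(\mu,\nu)=\inf_{\zeta\in\Pi(\mu,\nu)}\int\tfrac12\|x-y\|^2\,d\zeta(x,y)+\epsilon\,KL(\zeta\,\|\,\mu\otimes\nu),$$ where $\Pi(\mu,\nu)$ is the set of couplings of $\mu$ and $\nu$, and, for probability measures $\mathcal V=(\nu_1,\dots,\nu_m)$ on $\mathbb R^d$ and $\lambda\in\mathbb R^m$ with $\lambda_j\ge0$ and $\sum_j\lambda_j=1$, let $F^\epsilon_{\lambda,\mathcal V}(\mu)=\sum_{j=1}^m\lambda_j\,OT_2^\epsilon(\mu,\nu_j)$ for $\mu\in\mathcal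 P_2(\mathbb R^d)$. A measure $\mu\in\mathcal P_2(\mathbb R^d)$ is a critical point of $F=F^\epsilon_{\lambda,\mathcal V}$ if there is a continuous function $\delta F(\mu):\mathbb R^d\to\mathbb R$, a derivative of $F$ at $\mu$, such that for every $\rho\in\mathcal P_2(\mathbb R^d)$ it is integrable with respect to $\chi=\rho-\mu$ and $$\lim_{t\to0^+}\frac{F(\mu+t\chi)-F(\mu)}{t}=\int\delta F(\mu)\,d\chi,$$ and such that $\delta F(\mu)$ is differentiable with $\nabla\delta F(\mu)(x)=0$ at $\mu$-almost every $x$. Suppose that $\nu_1,\dots,\nu_m$ are $\sigma$-subgaussian. Then every critical point $\mu$ of $F^\epsilon_{\lambda,\mathcal V}$ is $\sigma$-subgaussian, and it is dominated in convex order by $\sum_j\lambda_j\nu_j$: for every convex $\varphi:\mathbb R^d\to\mathbb R$ that is integrable with respect to $\sum_j\lambda_j\nu_j$, $\varphi$ is $\mu$-integrable and $\int\varphi\,d\mu\le\sum_j\lambda_j\int\varphi\,d\nu_j$. In particular, every minimizer of $F^\epsilon_{\lambda,\mathcal V}$ over $\mathcal P_2(\mathbb R^d)$ is $\sigma$-subgaussian.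 -/

import Mathlib

open MeasureTheory Filter Topology
open scoped ENNReal NNReal

namespace EntropicBarycenter

/-- Borel probability measures on `ℝ^d` with finite second moment. -/
def P2 (d : ℕ) : Set (Measure (EuclideanSpace ℝ (Fin d))) :=
  {μ | IsProbabilityMeasure μ ∧ ∫⁻ x, ENNReal.ofReal (‖x‖ ^ 2) ∂μ < ∞}

/-- The moment bound `sup_{‖v‖ = 1} E exp(⟨X, v⟩² / s²) ≤ 2` for `X ∼ μ` (used for `s > 0`). -/
def ExpSqMomentBound {d : ℕ} (μ : Measure (EuclideanSpace ℝ (Fin d))) (s : ℝ≥0) : Prop :=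
  ∀ v : EuclideanSpace ℝ (Fin d), ‖v‖ = 1 →
    ∫⁻ x, ENNReal.ofReal (Real.exp ((inner ℝ x v) ^ 2 / (s : ℝ) ^ 2)) ∂μ ≤ 2

/-- The subgaussian norm: the least `s` such that the moment bound holds. It is taken as an infimum
over `s > 0`, and it is `∞` if there is no such `s`. -/
noncomputable def subgaussianNorm {d : ℕ} (μ : Measure (EuclideanSpace ℝ (Fin d))) : ℝ≥0∞ :=
  ⨅ (s : ℝ≥0) (_ : 0 < s ∧ ExpSqMomentBound μ s), (s : ℝ≥0∞)

/-- The `σ`-subgaussian probability measures on `ℝ^d`: those of subgaussian norm at most `σ`. -/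
def subgaussianMeasures (d : ℕ) (σ : ℝ≥0) : Set (Measure (EuclideanSpace ℝ (Fin d))) :=
  {μ | IsProbabilityMeasure μ ∧ subgaussianNorm μ ≤ σ}

/-- Couplings of `μ` and `ν`: measures on the product with marginals `μ` and `ν`. -/
def couplings {d : ℕ} (μ ν : Measure (EuclideanSpace ℝ (Fin d))) :
    Set (Measure (EuclideanSpace ℝ (Fin d) × EuclideanSpace ℝ (Fin d))) :=
  {ζ | ζ.map Prod.fst = μ ∧ ζ.map Prod.snd = ν}

/-- The entropy-regularized transport cost
`inf_ζ ∫ ‖x - y‖² / 2 dζ(x, y) + ε KL(ζ ‖ μ ⊗ ν)` over couplings `ζ`, computed in `[0, ∞]` and then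
read as a real number (it is finite on `P2`, as the product coupling shows). -/
noncomputable def entropicCost {d : ℕ} (ε : ℝ) (μ ν : Measure (EuclideanSpace ℝ (Fin d))) : ℝ :=
  (⨅ ζ ∈ couplings μ ν,
    (∫⁻ p, ENNReal.ofReal (‖p.1 - p.2‖ ^ 2 / 2) ∂ζ
      + ENNReal.ofReal ε * InformationTheory.klDiv ζ (μ.prod ν))).toReal

/-- The entropic barycenter functional `μ ↦ ∑ j, w j * OT^ε(μ, ν j)`. -/
noncomputable def barycenterFunctional {d m : ℕ} (ε : ℝ) (w : Fin m → ℝ)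
    (ν : Fin m → Measure (EuclideanSpace ℝ (Fin d)))
    (μ : Measure (EuclideanSpace ℝ (Fin d))) : ℝ :=
  ∑ j, w j * entropicCost ε μ (ν j)

/-- The mixture `(1 - t) μ + t ρ = μ + t (ρ - μ)`, for `t ∈ [0, 1]`. -/
noncomputable def mix {d : ℕ} (μ ρ : Measure (EuclideanSpace ℝ (Fin d))) (t : ℝ) :
    Measure (EuclideanSpace ℝ (Fin d)) :=
  ENNReal.ofReal (1 - t) • μ + ENNReal.ofReal t • ρ

/-- `f` is a derivative of the functional `F` on `U` at `μ`: `f` is continuous and, for every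
`ρ ∈ U`, it is integrable against `χ = ρ - μ` and the one-sided directional derivative of `F` at `μ`
along `χ` is `∫ f dχ = ∫ f dρ - ∫ f dμ`. -/
def HasDerivative {d : ℕ} (F : Measure (EuclideanSpace ℝ (Fin d)) → ℝ)
    (U : Set (Measure (EuclideanSpace ℝ (Fin d)))) (μ : Measure (EuclideanSpace ℝ (Fin d)))
    (f : EuclideanSpace ℝ (Fin d) → ℝ) : Prop :=
  Continuous f ∧ ∀ ρ ∈ U, Integrable f ρ ∧ Integrable f μ ∧
    Tendsto (fun t : ℝ => (F (mix μ ρ t) - F μ) / t) (𝓝[>] 0) (𝓝 (∫ x, f x ∂ρ - ∫ x, f x ∂μ))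

/-- `μ` is a critical point of `F` on `U`: `F` has a derivative at `μ ∈ U` whose gradient exists and
vanishes at `μ`-almost every point. -/
def IsCriticalPoint {d : ℕ} (F : Measure (EuclideanSpace ℝ (Fin d)) → ℝ)
    (U : Set (Measure (EuclideanSpace ℝ (Fin d)))) (μ : Measure (EuclideanSpace ℝ (Fin d))) :
    Prop :=
  μ ∈ U ∧ ∃ f : EuclideanSpace ℝ (Fin d) → ℝ, HasDerivative F U μ f ∧
    ∀ᵐ x ∂μ, HasGradientAt f 0 x

/-- Convex order `μ ≤_c ν`: `∫ φ dμ ≤ ∫ φ dν` for all convex `φ : ℝ^d → ℝ`. For measures with finite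
first moment both integrals make sense in `(-∞, ∞]`, and the inequality is void if the right-hand
side is `∞`; otherwise the left-hand side has to be finite too. -/
def ConvexOrder {d : ℕ} (μ ν : Measure (EuclideanSpace ℝ (Fin d))) : Prop :=
  ∀ φ : EuclideanSpace ℝ (Fin d) → ℝ, ConvexOn ℝ Set.univ φ → Integrable φ ν →
    Integrable φ μ ∧ ∫ x, φ x ∂μ ≤ ∫ x, φ x ∂ν

end EntropicBarycenter

/-!
The first-order condition on `μ` is tested against the maps `x ↦ x - s g(x)`, with `g` a bounded
measurable field, and no dual potentials are needed.

If `ζ j` are couplings of `μ` and `ν j`, nearly optimal for the entropic costs, mix each of them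
with its image under `(x, y) ↦ (x - s g(x), y)`. By the data processing inequality
(`klDiv_mix_map_le`) this does not increase the entropic part of the cost, so that
`exists_coupling_entropicCost_mix_le` bounds the functional on the segment from `μ` to its image
under `x ↦ x - s g(x)` by the change of the quadratic transport cost, which is
`s ∑ j, w j ∫ ⟪g(x), y - x⟫ dζ j + O(s²)` per unit of mass moved. On the other hand the functional
changes at least by the increment of the integral of `f`, where `f` is the derivative at a critical
point, or `f = 0` at a minimizer (`HasFirstOrderLowerBound`). This increment is `o(s)`, because the
gradient of `f` vanishes `μ`-almost everywhere; the estimate is uniform only on closed sets of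
almost full measure (`exists_isClosed_increment_le`), and `g` is set to zero elsewhere. In the
limit, `∑ j, w j ∫ ⟪g(x), y - x⟫ dζ j ≥ -η` for every `η > 0` and suitable couplings depending
on `η` (`exists_couplings_inner_ge`): approximately, `x` is the average of the conditional means
of `y`.

Taking for `g` a subgradient of a finite maximum `φ` of affine functions and integrating
`φ(y) ≥ φ(x) + ⟪g(x), y - x⟫` gives `∫ φ dμ ≤ ∑ j, w j ∫ φ dν j`
(`integral_le_sum_of_subgradient`). Every convex function is an increasing limit of such maxima,
whence the convex order (`convexOrder_of_hasFirstOrderLowerBound`). Subgaussianity follows by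
applying it to the convex functions `x ↦ exp (⟪x, v⟫² / s²)` with `s > σ`
(`ConvexOrder.mem_subgaussianMeasures`).
-/

namespace EntropicBarycenter

variable {d : ℕ}

/-! ### Measures with finite second moment and their couplings -/

lemma integrable_norm_sq_of_mem_P2 {μ : Measure (EuclideanSpace ℝ (Fin d))} (hμ : μ ∈ P2 d) :
    Integrable (fun x => ‖x‖ ^ 2) μ :=
  ⟨by fun_prop, by
    rw [hasFiniteIntegral_iff_ofReal (ae_of_all _ fun x => by positivity)]; exact hμ.2⟩

lemma mem_P2_of_integrable {μ : Measure (EuclideanSpace ℝ (Fin d))} [h : IsProbabilityMeasure μ]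
    (hμ : Integrable (fun x => ‖x‖ ^ 2) μ) : μ ∈ P2 d :=
  ⟨h, (hasFiniteIntegral_iff_ofReal (ae_of_all _ fun x => by positivity)).1 hμ.2⟩

lemma integrable_norm_of_mem_P2 {μ : Measure (EuclideanSpace ℝ (Fin d))} (hμ : μ ∈ P2 d) :
    Integrable (fun x => ‖x‖) μ := by
  have := hμ.1
  refine ((integrable_norm_sq_of_mem_P2 hμ).add (integrable_const (1 : ℝ))).mono' (by fun_prop)
    (ae_of_all _ fun x => ?_)
  simp only [norm_norm, Pi.add_apply]
  nlinarith [sq_nonneg (‖x‖ - 1), sq_nonneg ‖x‖]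

lemma mix_mem_P2 {μ ρ : Measure (EuclideanSpace ℝ (Fin d))} (hμ : μ ∈ P2 d) (hρ : ρ ∈ P2 d) {t : ℝ}
    (h0 : 0 ≤ t) (h1 : t ≤ 1) : mix μ ρ t ∈ P2 d := by
  have := hμ.1
  have := hρ.1
  have : IsProbabilityMeasure (EntropicBarycenter.mix μ ρ t) := ⟨by
    simp [EntropicBarycenter.mix, ← ENNReal.ofReal_add (sub_nonneg.2 h1) h0]⟩
  exact mem_P2_of_integrable <|
    ((integrable_norm_sq_of_mem_P2 hμ).smul_measure (by simp)).add_measure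
      ((integrable_norm_sq_of_mem_P2 hρ).smul_measure (by simp))

lemma map_add_mem_P2 {μ : Measure (EuclideanSpace ℝ (Fin d))} (hμ : μ ∈ P2 d)
    {u : EuclideanSpace ℝ (Fin d) → EuclideanSpace ℝ (Fin d)} (hu : Measurable u) {L : ℝ}
    (hL : ∀ x, ‖u x‖ ≤ L) : μ.map (fun x => x + u x) ∈ P2 d := by
  have := hμ.1
  have hT : Measurable fun x => x + u x := measurable_id.add hu
  have : IsProbabilityMeasure (μ.map (fun x => x + u x)) :=
    Measure.isProbabilityMeasure_map hT.aemeasurable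
  refine mem_P2_of_integrable ((integrable_map_measure (by fun_prop) hT.aemeasurable).2 ?_)
  refine (((integrable_norm_sq_of_mem_P2 hμ).const_mul 2).add (integrable_const (2 * L ^ 2))).mono'
    (by fun_prop) (ae_of_all _ fun x => ?_)
  simp only [Function.comp_apply, Pi.add_apply, norm_pow, norm_norm]
  have h1 := norm_add_le x (u x)
  have h2 := hL x
  nlinarith [norm_nonneg (x + u x), norm_nonneg x, norm_nonneg (u x), sq_nonneg (‖x‖ - L)]

lemma isProbabilityMeasure_of_mem_couplings {μ ν : Measure (EuclideanSpace ℝ (Fin d))}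
    [IsProbabilityMeasure μ]
    {ζ : Measure (EuclideanSpace ℝ (Fin d) × EuclideanSpace ℝ (Fin d))}
    (hζ : ζ ∈ couplings μ ν) : IsProbabilityMeasure ζ := by
  have h : IsProbabilityMeasure (ζ.map Prod.fst) := by rw [hζ.1]; infer_instance
  exact (Measure.isProbabilityMeasure_map_iff measurable_fst.aemeasurable).1 h

section Marginals

variable {μ ν : Measure (EuclideanSpace ℝ (Fin d))}
  {ζ : Measure (EuclideanSpace ℝ (Fin d) × EuclideanSpace ℝ (Fin d))}

lemma integrable_fst_of_mem_couplings (hζ : ζ ∈ couplings μ ν)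
    {h : EuclideanSpace ℝ (Fin d) → ℝ} (hh : Integrable h μ) : Integrable (fun p => h p.1) ζ := by
  rw [← hζ.1] at hh
  exact hh.comp_measurable measurable_fst

lemma integrable_snd_of_mem_couplings (hζ : ζ ∈ couplings μ ν)
    {h : EuclideanSpace ℝ (Fin d) → ℝ} (hh : Integrable h ν) : Integrable (fun p => h p.2) ζ := by
  rw [← hζ.2] at hh
  exact hh.comp_measurable measurable_snd

lemma integral_fst_of_mem_couplings (hζ : ζ ∈ couplings μ ν)
    {h : EuclideanSpace ℝ (Fin d) → ℝ} (hh : Integrable h μ) :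
    ∫ p, h p.1 ∂ζ = ∫ x, h x ∂μ := by
  have h1 := hh.aestronglyMeasurable
  rw [← hζ.1] at h1 ⊢
  exact (integral_map measurable_fst.aemeasurable h1).symm

lemma integral_snd_of_mem_couplings (hζ : ζ ∈ couplings μ ν)
    {h : EuclideanSpace ℝ (Fin d) → ℝ} (hh : Integrable h ν) :
    ∫ p, h p.2 ∂ζ = ∫ x, h x ∂ν := by
  have h1 := hh.aestronglyMeasurable
  rw [← hζ.2] at h1 ⊢
  exact (integral_map measurable_snd.aemeasurable h1).symm

lemma integrable_sub_sq_of_mem_couplings (hμ : μ ∈ P2 d) (hν : ν ∈ P2 d)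
    (hζ : ζ ∈ couplings μ ν) : Integrable (fun p => ‖p.1 - p.2‖ ^ 2 / 2) ζ := by
  refine ((integrable_fst_of_mem_couplings hζ (integrable_norm_sq_of_mem_P2 hμ)).add
    (integrable_snd_of_mem_couplings hζ (integrable_norm_sq_of_mem_P2 hν))).mono'
    (by fun_prop) (ae_of_all _ fun p => ?_)
  simp only [Pi.add_apply, norm_div, norm_pow, norm_norm, Real.norm_ofNat]
  nlinarith [norm_sub_le p.1 p.2, norm_nonneg (p.1 - p.2), sq_nonneg (‖p.1‖ - ‖p.2‖)]

lemma integrable_inner_of_mem_couplings (hμ : μ ∈ P2 d) (hν : ν ∈ P2 d)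
    (hζ : ζ ∈ couplings μ ν) {g : EuclideanSpace ℝ (Fin d) → EuclideanSpace ℝ (Fin d)}
    (hg : Measurable g) {L : ℝ} (hL : ∀ x, ‖g x‖ ≤ L) :
    Integrable (fun p => inner ℝ (g p.1) (p.2 - p.1)) ζ := by
  refine (((integrable_fst_of_mem_couplings hζ (integrable_norm_of_mem_P2 hμ)).add
    (integrable_snd_of_mem_couplings hζ (integrable_norm_of_mem_P2 hν))).const_mul L).mono'
    ?_ (ae_of_all _ fun p => ?_)
  · exact ((hg.comp measurable_fst).inner (measurable_snd.sub measurable_fst)).aestronglyMeasurable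
  · refine (norm_inner_le_norm _ _).trans ?_
    rw [Pi.add_apply, add_comm ‖p.1‖]
    exact mul_le_mul (hL _) (norm_sub_le _ _) (norm_nonneg _) ((norm_nonneg _).trans (hL p.1))

end Marginals

/-! ### Subgaussian measures -/

lemma ExpSqMomentBound.mono {μ : Measure (EuclideanSpace ℝ (Fin d))} {r s : ℝ≥0} (hr : 0 < r)
    (hrs : r ≤ s) (h : ExpSqMomentBound μ r) : ExpSqMomentBound μ s := fun v hv =>
  (lintegral_mono fun x => by gcongr).trans (h v hv)

lemma expSqMomentBound_of_lt {μ : Measure (EuclideanSpace ℝ (Fin d))} {σ s : ℝ≥0}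
    (hμ : μ ∈ subgaussianMeasures d σ) (hs : σ < s) : ExpSqMomentBound μ s := by
  have h : subgaussianNorm μ < s := hμ.2.trans_lt (by exact_mod_cast hs)
  simp only [subgaussianNorm, iInf_lt_iff] at h
  obtain ⟨r, ⟨hr, hr'⟩, hrs⟩ := h
  exact hr'.mono hr (by exact_mod_cast hrs.le)

lemma mem_subgaussianMeasures {μ : Measure (EuclideanSpace ℝ (Fin d))} [h : IsProbabilityMeasure μ]
    {σ : ℝ≥0} (hμ : ∀ s : ℝ≥0, σ < s → ExpSqMomentBound μ s) : μ ∈ subgaussianMeasures d σ := by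
  refine ⟨h, le_of_forall_gt fun c hc => ?_⟩
  obtain ⟨s, hs, hsc⟩ := ENNReal.lt_iff_exists_nnreal_btwn.1 hc
  have hs' : σ < s := by exact_mod_cast hs
  exact (iInf₂_le s ⟨bot_le.trans_lt hs', hμ s hs'⟩).trans_lt hsc

lemma mem_P2_of_mem_subgaussianMeasures {μ : Measure (EuclideanSpace ℝ (Fin d))} {σ : ℝ≥0}
    (hμ : μ ∈ subgaussianMeasures d σ) : μ ∈ P2 d := by
  refine ⟨hμ.1, ?_⟩
  set s : ℝ≥0 := σ + 1
  have hs : (0 : ℝ) < s := by positivity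
  have hb : ExpSqMomentBound μ s := expSqMomentBound_of_lt hμ (lt_add_one σ)
  let e : Fin d → EuclideanSpace ℝ (Fin d) := fun i => EuclideanSpace.single i 1
  calc ∫⁻ x, ENNReal.ofReal (‖x‖ ^ 2) ∂μ
      ≤ ∫⁻ x, ∑ i, ENNReal.ofReal ((s : ℝ) ^ 2) *
          ENNReal.ofReal (Real.exp ((inner ℝ x (e i)) ^ 2 / (s : ℝ) ^ 2)) ∂μ := by
        refine lintegral_mono fun x => ?_
        simp only [← ENNReal.ofReal_mul (sq_nonneg (s : ℝ))]
        rw [← ENNReal.ofReal_sum_of_nonneg fun i _ => by positivity]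
        refine ENNReal.ofReal_le_ofReal ?_
        rw [EuclideanSpace.real_norm_sq_eq]
        refine Finset.sum_le_sum fun i _ => ?_
        have h1 := Real.add_one_le_exp ((inner ℝ x (e i)) ^ 2 / (s : ℝ) ^ 2)
        have h2 : inner ℝ x (e i) = x i := by simp [e, EuclideanSpace.inner_single_right]
        rw [h2] at h1 ⊢
        calc x i ^ 2 = (s : ℝ) ^ 2 * (x i ^ 2 / (s : ℝ) ^ 2) := by field_simp
          _ ≤ _ := by gcongr; linarith
    _ = ∑ i, ENNReal.ofReal ((s : ℝ) ^ 2) *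
          ∫⁻ x, ENNReal.ofReal (Real.exp ((inner ℝ x (e i)) ^ 2 / (s : ℝ) ^ 2)) ∂μ := by
        rw [lintegral_finsetSum _ fun i _ => by fun_prop]
        exact Finset.sum_congr rfl fun i _ => lintegral_const_mul _ (by fun_prop)
    _ < ∞ := by
        refine ENNReal.sum_lt_top.2 fun i _ => ENNReal.mul_lt_top ENNReal.ofReal_lt_top ?_
        exact (hb (e i) (by simp [e])).trans_lt (by simp)

/-! ### Finite maxima of affine functions -/

/-- A finite maximum of affine functions has a bounded measurable selection of subgradients. -/
lemma exists_measurable_subgradient_partialSups {E : Type*} [NormedAddCommGroup E]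
    [InnerProductSpace ℝ E] [CompleteSpace E] [MeasurableSpace E] [BorelSpace E]
    (l : ℕ → E →L[ℝ] ℝ) (c : ℕ → ℝ) (n : ℕ) :
    ∃ g : E → E, Measurable g ∧ (∃ L, ∀ x, ‖g x‖ ≤ L) ∧
      Measurable (partialSups (fun i => ⇑(l i) + Function.const E (c i)) n) ∧
      ∀ x y, partialSups (fun i => ⇑(l i) + Function.const E (c i)) n x + inner ℝ (g x) (y - x) ≤
        partialSups (fun i => ⇑(l i) + Function.const E (c i)) n y := by
  have hm : ∀ i, Measurable (⇑(l i) + Function.const E (c i)) := fun i =>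
    (l i).continuous.measurable.add measurable_const
  induction n with
  | zero =>
    refine ⟨fun _ => (InnerProductSpace.toDual ℝ E).symm (l 0), measurable_const,
      ⟨_, fun _ => le_rfl⟩, by simpa using hm 0, fun x y => ?_⟩
    simp
    linarith
  | succ n ih =>
    obtain ⟨g, hg, ⟨L, hL⟩, hψ, h⟩ := ih
    classical
    rw [partialSups_add_one]
    set ψ := partialSups (fun i => ⇑(l i) + Function.const E (c i)) n
    refine ⟨fun x => if (⇑(l (n + 1)) + Function.const E (c (n + 1))) x ≤ ψ x then g x
      else (InnerProductSpace.toDual ℝ E).symm (l (n + 1)),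
      Measurable.ite (measurableSet_le (hm _) hψ) hg measurable_const,
      ⟨max L ‖(InnerProductSpace.toDual ℝ E).symm (l (n + 1))‖, fun x => ?_⟩,
      hψ.sup (hm _), fun x y => ?_⟩
    · dsimp only
      split_ifs
      · exact (hL x).trans (le_max_left _ _)
      · exact le_max_right _ _
    · simp only [Pi.sup_apply]
      split_ifs with hx
      · rw [sup_eq_left.2 hx]
        exact (h x y).trans le_sup_left
      · rw [sup_eq_right.2 (not_le.1 hx).le]
        refine le_trans (le_of_eq ?_) le_sup_right
        simp
        ring

/-! ### Perturbing couplings -/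

/-- The Kullback-Leibler divergence does not increase if both measures are mixed with their images
under the same map: this is the data processing inequality for the Markov kernel
`x ↦ (1 - t) δ_x + t δ_{S x}`. -/
lemma klDiv_mix_map_le {α : Type*} [MeasurableSpace α] (ζ η : Measure α) [IsFiniteMeasure ζ]
    [IsFiniteMeasure η] {S : α → α} (hS : Measurable S) {t : ℝ} (h0 : 0 ≤ t) (h1 : t ≤ 1) :
    InformationTheory.klDiv (ENNReal.ofReal (1 - t) • ζ + ENNReal.ofReal t • ζ.map S)
      (ENNReal.ofReal (1 - t) • η + ENNReal.ofReal t • η.map S) ≤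
        InformationTheory.klDiv ζ η := by
  let κ : ProbabilityTheory.Kernel α α :=
    ⟨fun x => ENNReal.ofReal (1 - t) • Measure.dirac x + ENNReal.ofReal t • Measure.dirac (S x), by
      refine Measure.measurable_of_measurable_coe _ fun s hs => ?_
      simp only [Measure.coe_add, Measure.coe_smul, Pi.add_apply, Pi.smul_apply, smul_eq_mul]
      exact (((Measure.measurable_coe hs).comp Measure.measurable_dirac).const_mul _).add
        (((Measure.measurable_coe hs).comp (Measure.measurable_dirac.comp hS)).const_mul _)⟩
  have hκ : ∀ x, κ x =
    ENNReal.ofReal (1 - t) • Measure.dirac x + ENNReal.ofReal t • Measure.dirac (S x) := fun _ => rfl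
  have : ProbabilityTheory.IsMarkovKernel κ := ⟨fun x => ⟨by
    simp [hκ, ← ENNReal.ofReal_add (sub_nonneg.2 h1) h0]⟩⟩
  have key : ∀ θ : Measure α,
      θ.bind κ = ENNReal.ofReal (1 - t) • θ + ENNReal.ofReal t • θ.map S := fun θ => by
    ext s hs
    rw [Measure.bind_apply hs κ.measurable.aemeasurable]
    simp only [hκ, Measure.coe_add, Measure.coe_smul, Pi.add_apply, Pi.smul_apply, smul_eq_mul,
      Measure.dirac_apply' _ hs, Measure.map_apply hS hs]
    rw [lintegral_add_left ((measurable_one.indicator hs).const_mul _),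
      lintegral_const_mul _ (measurable_one.indicator hs), lintegral_indicator_one hs]
    congr 1
    exact (lintegral_const_mul _ ((measurable_one.indicator hs).comp hS)).trans
      (congrArg _ (lintegral_indicator_one (hS hs)))
  rw [← key, ← key]
  exact InformationTheory.klDiv_comp_right_le ζ η κ

/-- A near-optimal coupling `ζ` of `μ` and `ν` yields, by mixing it with its image under
`(x, y) ↦ (T x, y)`, an upper bound for the entropic cost along the segment from `μ` to the image
of `μ` under `T`, in which only the transport part of the cost changes. -/
lemma exists_coupling_entropicCost_mix_le {ε : ℝ} {μ ν : Measure (EuclideanSpace ℝ (Fin d))}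
    (hμ : μ ∈ P2 d) (hν : ν ∈ P2 d) {T : EuclideanSpace ℝ (Fin d) → EuclideanSpace ℝ (Fin d)}
    (hT : Measurable T) (hTμ : μ.map T ∈ P2 d) {δ : ℝ} (hδ : 0 < δ) :
    ∃ ζ ∈ couplings μ ν, Integrable (fun p => ‖T p.1 - p.2‖ ^ 2 / 2) ζ ∧
      ∀ t : ℝ, 0 ≤ t → t ≤ 1 → entropicCost ε (mix μ (μ.map T) t) ν ≤ entropicCost ε μ ν + δ +
        t * (∫ p, ‖T p.1 - p.2‖ ^ 2 / 2 ∂ζ - ∫ p, ‖p.1 - p.2‖ ^ 2 / 2 ∂ζ) := by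
  have := hμ.1
  have := hν.1
  have := hTμ.1
  set J : Measure (EuclideanSpace ℝ (Fin d)) →
      Measure (EuclideanSpace ℝ (Fin d) × EuclideanSpace ℝ (Fin d)) → ℝ≥0∞ := fun μ ζ =>
    ∫⁻ p, ENNReal.ofReal (‖p.1 - p.2‖ ^ 2 / 2) ∂ζ
      + ENNReal.ofReal ε * InformationTheory.klDiv ζ (μ.prod ν) with hJ
  have hcost : ∀ ζ : Measure (EuclideanSpace ℝ (Fin d) × EuclideanSpace ℝ (Fin d)),
      Integrable (fun p => ‖p.1 - p.2‖ ^ 2 / 2) ζ →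
      ∫⁻ p, ENNReal.ofReal (‖p.1 - p.2‖ ^ 2 / 2) ∂ζ =
        ENNReal.ofReal (∫ p, ‖p.1 - p.2‖ ^ 2 / 2 ∂ζ) := fun ζ h =>
    (ofReal_integral_eq_lintegral_ofReal h (ae_of_all _ fun p => by positivity)).symm
  have hfin : (⨅ ζ ∈ couplings μ ν, J μ ζ) ≠ ∞ := by
    have hprod : μ.prod ν ∈ couplings μ ν := ⟨by simp, by simp⟩
    refine ((iInf₂_le _ hprod).trans_lt ?_).ne
    simp only [hJ, InformationTheory.klDiv_self, mul_zero, add_zero]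
    rw [hcost _ (integrable_sub_sq_of_mem_couplings hμ hν hprod)]
    exact ENNReal.ofReal_lt_top
  obtain ⟨ζ, hζ, hlt⟩ : ∃ ζ ∈ couplings μ ν,
      J μ ζ < (⨅ ζ ∈ couplings μ ν, J μ ζ) + ENNReal.ofReal δ := by
    have := ENNReal.lt_add_right hfin (ENNReal.ofReal_pos.2 hδ).ne'
    rw [iInf_lt_iff] at this
    obtain ⟨ζ, h⟩ := this
    rw [iInf_lt_iff] at h
    exact ⟨ζ, h.1, h.2⟩
  have := isProbabilityMeasure_of_mem_couplings hζ
  set S : EuclideanSpace ℝ (Fin d) × EuclideanSpace ℝ (Fin d) →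
    EuclideanSpace ℝ (Fin d) × EuclideanSpace ℝ (Fin d) := Prod.map T id with hSdef
  have hS : Measurable S := hT.prodMap measurable_id
  have hζS : ζ.map S ∈ couplings (μ.map T) ν := by
    constructor
    · rw [Measure.map_map measurable_fst hS, ← hζ.1, Measure.map_map hT measurable_fst]
      rfl
    · rw [Measure.map_map measurable_snd hS, ← hζ.2]
      rfl
  have hint := integrable_sub_sq_of_mem_couplings hμ hν hζ
  have hintS := integrable_sub_sq_of_mem_couplings hTμ hν hζS
  have hintT : Integrable (fun p => ‖T p.1 - p.2‖ ^ 2 / 2) ζ := hintS.comp_measurable hS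
  have heqS : ∫ p, ‖p.1 - p.2‖ ^ 2 / 2 ∂(ζ.map S) = ∫ p, ‖T p.1 - p.2‖ ^ 2 / 2 ∂ζ :=
    integral_map hS.aemeasurable hintS.aestronglyMeasurable
  refine ⟨ζ, hζ, hintT, fun t h0 h1 => ?_⟩
  set a := ∫ p, ‖p.1 - p.2‖ ^ 2 / 2 ∂ζ
  set b := ∫ p, ‖T p.1 - p.2‖ ^ 2 / 2 ∂ζ
  have ha0 : 0 ≤ a := integral_nonneg fun p => by positivity
  have hb0 : 0 ≤ b := integral_nonneg fun p => by positivity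
  set K : ℝ≥0∞ := ENNReal.ofReal ε * InformationTheory.klDiv ζ (μ.prod ν) with hK
  have hJζ : J μ ζ = ENNReal.ofReal a + K := by simp only [hJ, ← hK]; rw [hcost _ hint]
  have hKfin : K ≠ ∞ := by
    have : J μ ζ ≠ ∞ := (hlt.trans (ENNReal.add_lt_top.2 ⟨hfin.lt_top, ENNReal.ofReal_lt_top⟩)).ne
    rw [hJζ] at this
    exact (ENNReal.add_ne_top.1 this).2
  have hle : a + K.toReal ≤ entropicCost ε μ ν + δ := by
    have := ENNReal.toReal_mono (ENNReal.add_ne_top.2 ⟨hfin, ENNReal.ofReal_ne_top⟩) hlt.le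
    rwa [hJζ, ENNReal.toReal_add ENNReal.ofReal_ne_top hKfin,
      ENNReal.toReal_add hfin ENNReal.ofReal_ne_top, ENNReal.toReal_ofReal ha0,
      ENNReal.toReal_ofReal hδ.le] at this
  -- the mixed coupling is a competitor for the mixed first marginal
  set ζt := ENNReal.ofReal (1 - t) • ζ + ENNReal.ofReal t • ζ.map S with hζt
  have hsum : ENNReal.ofReal (1 - t) + ENNReal.ofReal t = 1 := by
    rw [← ENNReal.ofReal_add (sub_nonneg.2 h1) h0]; simp
  have hmem : ζt ∈ couplings (mix μ (μ.map T) t) ν := by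
    constructor
    · rw [hζt, Measure.map_add _ _ measurable_fst, Measure.map_smul, Measure.map_smul, hζ.1,
        hζS.1]
      rfl
    · rw [hζt, Measure.map_add _ _ measurable_snd, Measure.map_smul, Measure.map_smul, hζ.2,
        hζS.2, ← add_smul, hsum, one_smul]
  have hprod : (mix μ (μ.map T) t).prod ν =
      ENNReal.ofReal (1 - t) • μ.prod ν + ENNReal.ofReal t • (μ.prod ν).map S := by
    have : (μ.map T).prod ν = (μ.prod ν).map S := by
      rw [hSdef, ← Measure.map_prod_map _ _ hT measurable_id, Measure.map_id]
    rw [mix, Measure.add_prod, Measure.prod_smul_left, Measure.prod_smul_left, this]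
  have hJt : J (mix μ (μ.map T) t) ζt ≤ ENNReal.ofReal ((1 - t) * a + t * b) + K := by
    simp only [hJ]
    refine add_le_add (le_of_eq ?_) ?_
    · rw [hζt, lintegral_add_measure, lintegral_smul_measure, lintegral_smul_measure, hcost _ hint,
        hcost _ hintS, heqS, smul_eq_mul, smul_eq_mul, ← ENNReal.ofReal_mul (sub_nonneg.2 h1),
        ← ENNReal.ofReal_mul h0, ← ENNReal.ofReal_add (mul_nonneg (sub_nonneg.2 h1) ha0)
          (mul_nonneg h0 hb0)]
    · rw [hprod, hK]
      exact mul_le_mul_right (klDiv_mix_map_le ζ (μ.prod ν) hS h0 h1) _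
  have hfinal : entropicCost ε (mix μ (μ.map T) t) ν ≤ (1 - t) * a + t * b + K.toReal := by
    have := ENNReal.toReal_mono (ENNReal.add_ne_top.2 ⟨ENNReal.ofReal_ne_top, hKfin⟩)
      ((iInf₂_le (f := fun ζ _ => J (mix μ (μ.map T) t) ζ) ζt hmem).trans hJt)
    rwa [ENNReal.toReal_add ENNReal.ofReal_ne_top hKfin, ENNReal.toReal_ofReal
      (add_nonneg (mul_nonneg (sub_nonneg.2 h1) ha0) (mul_nonneg h0 hb0))] at this
  linarith

/-! ### First-order lower bounds -/

/-- `f` bounds the one-sided directional derivatives of `F` at `μ` from below, along the segments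
from `μ` to the measures in `P2`. A derivative has this property, and at a minimizer
of `F` the function `f = 0` has it. -/
def HasFirstOrderLowerBound (F : Measure (EuclideanSpace ℝ (Fin d)) → ℝ)
    (μ : Measure (EuclideanSpace ℝ (Fin d))) (f : EuclideanSpace ℝ (Fin d) → ℝ) : Prop :=
  ∀ ρ ∈ P2 d, Integrable f ρ ∧ ∀ η : ℝ, 0 < η → ∃ t : ℝ, 0 < t ∧ t ≤ 1 ∧
    t * (∫ x, f x ∂ρ - ∫ x, f x ∂μ - η) ≤ F (mix μ ρ t) - F μ

lemma HasDerivative.hasFirstOrderLowerBound {F : Measure (EuclideanSpace ℝ (Fin d)) → ℝ}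
    {μ : Measure (EuclideanSpace ℝ (Fin d))} {f : EuclideanSpace ℝ (Fin d) → ℝ}
    (h : HasDerivative F (P2 d) μ f) : HasFirstOrderLowerBound F μ f := by
  intro ρ hρ
  obtain ⟨h1, -, h2⟩ := h.2 ρ hρ
  refine ⟨h1, fun η hη => ?_⟩
  have h3 := h2.eventually (lt_mem_nhds (sub_lt_self (∫ x, f x ∂ρ - ∫ x, f x ∂μ) hη))
  obtain ⟨t, ht, ht0, ht1⟩ := (h3.and (Ioc_mem_nhdsGT zero_lt_one)).exists
  refine ⟨t, ht0, ht1, ?_⟩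
  rw [lt_div_iff₀ ht0] at ht
  linarith

lemma hasFirstOrderLowerBound_zero_of_isMinOn {F : Measure (EuclideanSpace ℝ (Fin d)) → ℝ}
    {μ : Measure (EuclideanSpace ℝ (Fin d))} (hμ : μ ∈ P2 d) (h : IsMinOn F (P2 d) μ) :
    HasFirstOrderLowerBound F μ 0 := by
  refine fun ρ hρ => ⟨integrable_zero _ _ _, fun η hη => ⟨1, one_pos, le_rfl, ?_⟩⟩
  have := isMinOn_iff.1 h _ (mix_mem_P2 hμ hρ zero_le_one le_rfl)
  simp only [Pi.zero_apply, integral_zero]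
  linarith

/-- The first variation along the maps `x ↦ x - s g(x)`. -/
lemma HasFirstOrderLowerBound.exists_couplings {m : ℕ} {ε : ℝ} {w : Fin m → ℝ}
    (hw : w ∈ stdSimplex ℝ (Fin m)) {ν : Fin m → Measure (EuclideanSpace ℝ (Fin d))}
    (hν : ∀ j, ν j ∈ P2 d) {μ : Measure (EuclideanSpace ℝ (Fin d))} (hμ : μ ∈ P2 d)
    {f : EuclideanSpace ℝ (Fin d) → ℝ}
    (hf : HasFirstOrderLowerBound (barycenterFunctional ε w ν) μ f)
    {g : EuclideanSpace ℝ (Fin d) → EuclideanSpace ℝ (Fin d)} (hg : Measurable g) {L : ℝ}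
    (hL : ∀ x, ‖g x‖ ≤ L) {s η : ℝ} (hη : 0 < η) :
    Integrable (fun x => f (x - s • g x)) μ ∧
    ∃ ζ : Fin m → Measure (EuclideanSpace ℝ (Fin d) × EuclideanSpace ℝ (Fin d)),
      (∀ j, ζ j ∈ couplings μ (ν j)) ∧
      ∫ x, f (x - s • g x) ∂μ - ∫ x, f x ∂μ ≤
        s * ∑ j, w j * ∫ p, inner ℝ (g p.1) (p.2 - p.1) ∂(ζ j) + s ^ 2 * L ^ 2 / 2 + η := by
  have := hμ.1
  have hT : Measurable fun x => x - s • g x := measurable_id.sub (hg.const_smul s)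
  have hTμ : μ.map (fun x => x - s • g x) ∈ P2 d := by
    have := map_add_mem_P2 hμ (u := fun x => -(s • g x)) (hg.const_smul s).neg (L := |s| * L)
      fun x => by
        rw [norm_neg, norm_smul, Real.norm_eq_abs]
        exact mul_le_mul_of_nonneg_left (hL x) (abs_nonneg s)
    simpa only [← sub_eq_add_neg] using this
  obtain ⟨hfi, hfb⟩ := hf _ hTμ
  refine ⟨hfi.comp_measurable hT, ?_⟩
  obtain ⟨t, ht0, ht1, ht⟩ := hfb (η / 2) (half_pos hη)
  choose ζ hζ hint hle using fun j => exists_coupling_entropicCost_mix_le (ε := ε) hμ (hν j) hT hTμ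
    (δ := t * (η / 2)) (by positivity)
  refine ⟨ζ, hζ, ?_⟩
  rw [integral_map hT.aemeasurable hfi.aestronglyMeasurable] at ht
  have hj : ∀ j, ∫ p, ‖p.1 - s • g p.1 - p.2‖ ^ 2 / 2 ∂(ζ j) - ∫ p, ‖p.1 - p.2‖ ^ 2 / 2 ∂(ζ j) ≤
      s * ∫ p, inner ℝ (g p.1) (p.2 - p.1) ∂(ζ j) + s ^ 2 * L ^ 2 / 2 := fun j => by
    have := isProbabilityMeasure_of_mem_couplings (hζ j)
    have hin := integrable_inner_of_mem_couplings hμ (hν j) (hζ j) hg hL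
    rw [← integral_sub (hint j) (integrable_sub_sq_of_mem_couplings hμ (hν j) (hζ j)),
      ← integral_const_mul]
    have hc : s ^ 2 * L ^ 2 / 2 = ∫ _, s ^ 2 * L ^ 2 / 2 ∂(ζ j) := by simp
    rw [hc, ← integral_add (hin.const_mul s) (integrable_const _)]
    refine integral_mono ((hint j).sub (integrable_sub_sq_of_mem_couplings hμ (hν j) (hζ j)))
      ((hin.const_mul s).add (integrable_const _)) fun p => ?_
    have h1 : p.1 - s • g p.1 - p.2 = -((p.2 - p.1) + s • g p.1) := by abel
    have h2 : ‖p.1 - p.2‖ = ‖p.2 - p.1‖ := norm_sub_rev _ _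
    have h3 : ‖g p.1‖ ^ 2 ≤ L ^ 2 := pow_le_pow_left₀ (norm_nonneg _) (hL _) 2
    simp only
    rw [h1, norm_neg, h2, norm_add_sq_real, inner_smul_right, real_inner_comm, norm_smul, mul_pow,
      Real.norm_eq_abs, sq_abs]
    nlinarith [mul_le_mul_of_nonneg_left h3 (sq_nonneg s)]
  have hF : barycenterFunctional ε w ν (mix μ (μ.map fun x => x - s • g x) t) -
      barycenterFunctional ε w ν μ ≤ t * (s * ∑ j, w j * ∫ p, inner ℝ (g p.1) (p.2 - p.1) ∂(ζ j) +
        s ^ 2 * L ^ 2 / 2 + η / 2) := by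
    simp only [barycenterFunctional]
    rw [← Finset.sum_sub_distrib]
    calc _ ≤ ∑ j, w j * (t * (s * ∫ p, inner ℝ (g p.1) (p.2 - p.1) ∂(ζ j) + s ^ 2 * L ^ 2 / 2 +
            η / 2)) := Finset.sum_le_sum fun j _ => by
          rw [← mul_sub]
          refine mul_le_mul_of_nonneg_left ?_ (hw.1 j)
          nlinarith [hle j t ht0.le ht1, mul_le_mul_of_nonneg_left (hj j) ht0.le]
      _ = (∑ j, t * (s * (w j * ∫ p, inner ℝ (g p.1) (p.2 - p.1) ∂(ζ j)))) +
            (∑ j, w j) * (t * (s ^ 2 * L ^ 2 / 2 + η / 2)) := by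
          rw [Finset.sum_mul, ← Finset.sum_add_distrib]
          exact Finset.sum_congr rfl fun j _ => by ring
      _ = _ := by
          rw [hw.2, ← Finset.mul_sum, ← Finset.mul_sum]
          ring
  linarith [le_of_mul_le_mul_left (ht.trans hF) ht0]

/-! ### Uniformity of vanishing gradients -/

/-- The increments of `f` at points where its gradient vanishes are `o(‖h‖)`, uniformly on closed
sets of almost full measure. -/
lemma exists_isClosed_increment_le {E : Type*} [NormedAddCommGroup E] [InnerProductSpace ℝ E]
    [CompleteSpace E] [MeasurableSpace E] [BorelSpace E] {μ : Measure E} [IsFiniteMeasure μ]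
    {f : E → ℝ} (hf : Continuous f) (hgrad : ∀ᵐ x ∂μ, HasGradientAt f 0 x) {c δ : ℝ} (hc : 0 < c)
    (hδ : 0 < δ) :
    ∃ (A : Set E) (r : ℝ), IsClosed A ∧ 0 < r ∧ μ.real Aᶜ < δ ∧
      ∀ x ∈ A, ∀ h, ‖h‖ ≤ r → |f (x + h) - f x| ≤ c * ‖h‖ := by
  let A : ℕ → Set E := fun n =>
    {x | ∀ h, ‖h‖ ≤ 1 / ((n : ℝ) + 1) → |f (x + h) - f x| ≤ c * ‖h‖}
  have hA : ∀ n, IsClosed (A n) := fun n => by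
    simp only [A, Set.ofPred_forall]
    exact isClosed_iInter fun h => isClosed_iInter fun _ =>
      isClosed_le (by fun_prop) continuous_const
  have hmono : Antitone fun n => (A n)ᶜ := fun n k hnk =>
    Set.compl_subset_compl.2 fun x hx h hh => hx h (hh.trans (Nat.one_div_le_one_div hnk))
  have hnull : μ (⋂ n, (A n)ᶜ) = 0 := by
    rw [← Set.compl_iUnion, ← mem_ae_iff]
    filter_upwards [hgrad] with x hx
    have h1 := hasFDerivAt_iff_isLittleO_nhds_zero.1 hx.hasFDerivAt
    have h2 := h1.def hc
    obtain ⟨r, hr, h3⟩ := Metric.eventually_nhds_iff.1 h2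
    obtain ⟨n, hn⟩ := exists_nat_one_div_lt hr
    refine Set.mem_iUnion.2 ⟨n, fun h hh => ?_⟩
    have := h3 (y := h) (by rw [dist_zero_right]; exact hh.trans_lt hn)
    simpa using this
  have hlim := tendsto_measure_iInter_atTop (μ := μ)
    (fun n => (hA n).measurableSet.compl.nullMeasurableSet) hmono ⟨0, measure_ne_top _ _⟩
  rw [hnull] at hlim
  obtain ⟨n, hn⟩ := (hlim.eventually (gt_mem_nhds (ENNReal.ofReal_pos.2 hδ))).exists
  refine ⟨A n, 1 / ((n : ℝ) + 1), hA n, by positivity, ?_, fun x hx => hx⟩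
  rw [measureReal_def, ← ENNReal.toReal_ofReal hδ.le]
  exact (ENNReal.toReal_lt_toReal (measure_ne_top _ _) ENNReal.ofReal_ne_top).2 hn

/-! ### Convex order -/

/-- Up to small errors, there are couplings of `μ` with the `ν j` whose barycentric projections
average to the identity when tested against a given bounded field `g`. -/
lemma exists_couplings_inner_ge {m : ℕ} {ε : ℝ} {w : Fin m → ℝ}
    (hw : w ∈ stdSimplex ℝ (Fin m)) {ν : Fin m → Measure (EuclideanSpace ℝ (Fin d))}
    (hν : ∀ j, ν j ∈ P2 d) {μ : Measure (EuclideanSpace ℝ (Fin d))} (hμ : μ ∈ P2 d)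
    {f : EuclideanSpace ℝ (Fin d) → ℝ} (hcont : Continuous f)
    (hf : HasFirstOrderLowerBound (barycenterFunctional ε w ν) μ f)
    (hgrad : ∀ᵐ x ∂μ, HasGradientAt f 0 x)
    {g : EuclideanSpace ℝ (Fin d) → EuclideanSpace ℝ (Fin d)} (hg : Measurable g) {L : ℝ}
    (hL0 : 0 < L) (hL : ∀ x, ‖g x‖ ≤ L) {η : ℝ} (hη : 0 < η) :
    ∃ ζ : Fin m → Measure (EuclideanSpace ℝ (Fin d) × EuclideanSpace ℝ (Fin d)),
      (∀ j, ζ j ∈ couplings μ (ν j)) ∧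
      -η ≤ ∑ j, w j * ∫ p, inner ℝ (g p.1) (p.2 - p.1) ∂(ζ j) := by
  have := hμ.1
  obtain ⟨η, rfl⟩ : ∃ η', η = 5 * η' := ⟨η / 5, by ring⟩
  replace hη : 0 < η := by linarith
  set M := ∫ x, ‖x‖ ^ 2 ∂μ + ∑ j, w j * ∫ y, ‖y‖ ^ 2 ∂(ν j) with hM
  have hM0 : 0 ≤ M := add_nonneg (integral_nonneg fun x => by positivity)
    (Finset.sum_nonneg fun j _ => mul_nonneg (hw.1 j) (integral_nonneg fun x => by positivity))
  set κ := η / (L * (M + 1)) with hκ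
  have hκ0 : 0 < κ := by positivity
  -- outside `A` the field is replaced by `0`; the scale `κ` balances the two resulting errors
  obtain ⟨A, r, hA, hr, hAμ, hAf⟩ := exists_isClosed_increment_le hcont hgrad
    (c := η / L) (δ := 2 * κ * η / L) (by positivity) (by positivity)
  have hAm := hA.measurableSet
  have hg' : Measurable (A.indicator g) := hg.indicator hAm
  have hL' : ∀ x, ‖A.indicator g x‖ ≤ L := fun x =>
    (norm_indicator_le_norm_self _ _).trans (hL x)
  set s := min (r / L) (2 * η / L ^ 2)
  have hs0 : 0 < s := by positivity
  have hsr : s * L ≤ r := (le_div_iff₀ hL0).1 (min_le_left _ _)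
  have hsη : s * L ^ 2 ≤ 2 * η := (le_div_iff₀ (by positivity)).1 (min_le_right _ _)
  obtain ⟨hfi, ζ, hζ, hle⟩ := hf.exists_couplings hw hν hμ hg' hL' (s := s) (η := s * η)
    (by positivity)
  refine ⟨ζ, hζ, ?_⟩
  have hfμ : Integrable f μ := (hf μ hμ).1
  have h1 : -(s * η) ≤ ∫ x, f (x - s • A.indicator g x) ∂μ - ∫ x, f x ∂μ := by
    rw [← integral_sub hfi hfμ]
    have : -(s * η) = ∫ _, -(s * η) ∂μ := by simp
    rw [this]
    refine integral_mono (integrable_const _) (hfi.sub hfμ) fun x => ?_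
    by_cases hx : x ∈ A
    · have hn : ‖-(s • g x)‖ ≤ s * L := by
        rw [norm_neg, norm_smul, Real.norm_of_nonneg hs0.le]
        exact mul_le_mul_of_nonneg_left (hL x) hs0.le
      have h2 := hAf x hx (-(s • g x)) (hn.trans hsr)
      have h3 : η / L * ‖-(s • g x)‖ ≤ s * η :=
        calc η / L * ‖-(s • g x)‖ ≤ η / L * (s * L) := by gcongr
          _ = s * η := by field_simp
      simp only [Set.indicator_of_mem hx, sub_eq_add_neg (x) (s • g x)]
      linarith [(abs_le.1 (h2.trans h3)).1]
    · simp only [Set.indicator_of_notMem hx, smul_zero, sub_zero, sub_self]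
      have := mul_pos hs0 hη
      linarith
  have h2 : -(3 * η) ≤ ∑ j, w j * ∫ p, inner ℝ (A.indicator g p.1) (p.2 - p.1) ∂(ζ j) := by
    refine le_of_mul_le_mul_left ?_ hs0
    nlinarith [mul_le_mul_of_nonneg_left hsη hs0.le]
  have h3 : ∀ j, ∫ p, inner ℝ (A.indicator g p.1) (p.2 - p.1) ∂(ζ j) -
      L * (κ * (∫ x, ‖x‖ ^ 2 ∂μ + ∫ y, ‖y‖ ^ 2 ∂(ν j)) + μ.real Aᶜ / (2 * κ)) ≤
      ∫ p, inner ℝ (g p.1) (p.2 - p.1) ∂(ζ j) := fun j => by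
    have hi1 := integrable_norm_sq_of_mem_P2 hμ
    have hi2 := integrable_norm_sq_of_mem_P2 (hν j)
    have hi3 : Integrable (Aᶜ.indicator fun _ => (1 : ℝ)) μ :=
      (integrable_const 1).indicator hAm.compl
    have hj1 := integrable_fst_of_mem_couplings (hζ j) hi1
    have hj2 := integrable_snd_of_mem_couplings (hζ j) hi2
    have hj3 := integrable_fst_of_mem_couplings (hζ j) hi3
    have hj12 : Integrable (fun p : EuclideanSpace ℝ (Fin d) × EuclideanSpace ℝ (Fin d) =>
        ‖p.1‖ ^ 2 + ‖p.2‖ ^ 2) (ζ j) := hj1.add hj2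
    have hk := integrable_inner_of_mem_couplings hμ (hν j) (hζ j) hg hL
    have hk' := integrable_inner_of_mem_couplings hμ (hν j) (hζ j) hg' hL'
    have e3 : ∫ p : EuclideanSpace ℝ (Fin d) × EuclideanSpace ℝ (Fin d),
        Aᶜ.indicator (fun _ => (1 : ℝ)) p.1 ∂(ζ j) = μ.real Aᶜ := by
      rw [integral_fst_of_mem_couplings (hζ j) hi3]
      exact integral_indicator_one hAm.compl
    have e : L * (κ * (∫ x, ‖x‖ ^ 2 ∂μ + ∫ y, ‖y‖ ^ 2 ∂(ν j)) + μ.real Aᶜ / (2 * κ)) =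
        ∫ p, L * (κ * (‖p.1‖ ^ 2 + ‖p.2‖ ^ 2) + Aᶜ.indicator (fun _ => (1 : ℝ)) p.1 / (2 * κ))
          ∂(ζ j) := by
      rw [integral_const_mul, integral_add (hj12.const_mul κ) (hj3.div_const _),
        integral_const_mul, integral_add hj1 hj2, integral_div, e3,
        integral_fst_of_mem_couplings (hζ j) hi1, integral_snd_of_mem_couplings (hζ j) hi2]
    have hJ : Integrable (fun p : EuclideanSpace ℝ (Fin d) × EuclideanSpace ℝ (Fin d) =>
        L * (κ * (‖p.1‖ ^ 2 + ‖p.2‖ ^ 2) + Aᶜ.indicator (fun _ => (1 : ℝ)) p.1 / (2 * κ))) (ζ j) :=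
      ((hj12.const_mul κ).add (hj3.div_const _)).const_mul L
    rw [e, ← integral_sub hk' hJ]
    refine integral_mono (hk'.sub hJ) hk fun p => ?_
    by_cases hp : p.1 ∈ A
    · have : p.1 ∉ Aᶜ := fun h => h hp
      simp only [Set.indicator_of_mem hp, Set.indicator_of_notMem this, zero_div, add_zero]
      have : 0 ≤ L * (κ * (‖p.1‖ ^ 2 + ‖p.2‖ ^ 2)) := by positivity
      linarith
    · have hp' : p.1 ∈ Aᶜ := hp
      simp only [Set.indicator_of_notMem hp, Set.indicator_of_mem hp', inner_zero_left, zero_sub]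
      have h4 : |inner ℝ (g p.1) (p.2 - p.1)| ≤ L * (‖p.2‖ + ‖p.1‖) :=
        (abs_real_inner_le_norm _ _).trans
          (mul_le_mul (hL _) (norm_sub_le _ _) (norm_nonneg _) hL0.le)
      have h5 : ∀ a : ℝ, a ≤ κ * a ^ 2 + 1 / (4 * κ) := fun a => by
        have : κ * a ^ 2 + 1 / (4 * κ) - a = κ * (a - 1 / (2 * κ)) ^ 2 := by field_simp; ring
        nlinarith [mul_nonneg hκ0.le (sq_nonneg (a - 1 / (2 * κ)))]
      have h6 : 1 / (2 * κ) = 1 / (4 * κ) + 1 / (4 * κ) := by field_simp; norm_num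
      have h7 : ‖p.2‖ + ‖p.1‖ ≤ κ * (‖p.1‖ ^ 2 + ‖p.2‖ ^ 2) + 1 / (2 * κ) := by
        rw [h6]
        linarith [h5 ‖p.1‖, h5 ‖p.2‖]
      linarith [(abs_le.1 h4).1, mul_le_mul_of_nonneg_left h7 hL0.le]
  have h4 : ∑ j, w j * ∫ p, inner ℝ (A.indicator g p.1) (p.2 - p.1) ∂(ζ j) -
      L * (κ * M + μ.real Aᶜ / (2 * κ)) ≤ ∑ j, w j * ∫ p, inner ℝ (g p.1) (p.2 - p.1) ∂(ζ j) := by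
    refine le_trans (le_of_eq ?_)
      (Finset.sum_le_sum fun j _ => mul_le_mul_of_nonneg_left (h3 j) (hw.1 j))
    have : ∀ j, w j * (∫ p, inner ℝ (A.indicator g p.1) (p.2 - p.1) ∂(ζ j) -
        L * (κ * (∫ x, ‖x‖ ^ 2 ∂μ + ∫ y, ‖y‖ ^ 2 ∂(ν j)) + μ.real Aᶜ / (2 * κ))) =
        w j * ∫ p, inner ℝ (A.indicator g p.1) (p.2 - p.1) ∂(ζ j) -
          (w j * (L * (κ * ∫ x, ‖x‖ ^ 2 ∂μ + μ.real Aᶜ / (2 * κ))) +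
            L * κ * (w j * ∫ y, ‖y‖ ^ 2 ∂(ν j))) := fun j => by ring
    simp only [this]
    rw [Finset.sum_sub_distrib, Finset.sum_add_distrib, ← Finset.sum_mul, ← Finset.mul_sum, hw.2,
      hM]
    ring
  have h5 : L * (κ * M) ≤ η := by
    have : L * (κ * M) = η * (M / (M + 1)) := by rw [hκ]; field_simp
    rw [this]
    exact mul_le_of_le_one_right hη.le ((div_le_one (by positivity)).2 (by linarith))
  have h6 : L * (μ.real Aᶜ / (2 * κ)) ≤ η := by
    have : L * ((2 * κ * η / L) / (2 * κ)) = η := by field_simp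
    rw [← this]
    gcongr
  linarith

lemma integral_le_sum_of_subgradient {m : ℕ} {ε : ℝ} {w : Fin m → ℝ}
    (hw : w ∈ stdSimplex ℝ (Fin m)) {ν : Fin m → Measure (EuclideanSpace ℝ (Fin d))}
    (hν : ∀ j, ν j ∈ P2 d) {μ : Measure (EuclideanSpace ℝ (Fin d))} (hμ : μ ∈ P2 d)
    {f : EuclideanSpace ℝ (Fin d) → ℝ} (hcont : Continuous f)
    (hf : HasFirstOrderLowerBound (barycenterFunctional ε w ν) μ f)
    (hgrad : ∀ᵐ x ∂μ, HasGradientAt f 0 x) {φ : EuclideanSpace ℝ (Fin d) → ℝ}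
    (hφμ : Integrable φ μ) (hφν : ∀ j, Integrable φ (ν j))
    {g : EuclideanSpace ℝ (Fin d) → EuclideanSpace ℝ (Fin d)} (hg : Measurable g) {L : ℝ}
    (hL : ∀ x, ‖g x‖ ≤ L) (hφg : ∀ x y, φ x + inner ℝ (g x) (y - x) ≤ φ y) :
    ∫ x, φ x ∂μ ≤ ∑ j, w j * ∫ x, φ x ∂(ν j) := by
  refine le_of_forall_pos_le_add fun η hη => ?_
  obtain ⟨ζ, hζ, h⟩ := exists_couplings_inner_ge hw hν hμ hcont hf hgrad hg
    (lt_max_of_lt_right one_pos : 0 < max L 1) (fun x => (hL x).trans (le_max_left _ _)) hη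
  have hj : ∀ j, ∫ x, φ x ∂μ + ∫ p, inner ℝ (g p.1) (p.2 - p.1) ∂(ζ j) ≤ ∫ x, φ x ∂(ν j) :=
    fun j => by
      have h1 := integrable_fst_of_mem_couplings (hζ j) hφμ
      have h2 := integrable_snd_of_mem_couplings (hζ j) (hφν j)
      have h3 := integrable_inner_of_mem_couplings hμ (hν j) (hζ j) hg hL
      rw [← integral_fst_of_mem_couplings (hζ j) hφμ,
        ← integral_snd_of_mem_couplings (hζ j) (hφν j), ← integral_add h1 h3]
      exact integral_mono (h1.add h3) h2 fun p => hφg p.1 p.2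
  have h1 := Finset.sum_le_sum fun j (_ : j ∈ Finset.univ) =>
    mul_le_mul_of_nonneg_left (hj j) (hw.1 j)
  simp only [mul_add] at h1
  rw [Finset.sum_add_distrib, ← Finset.sum_mul, hw.2, one_mul] at h1
  linarith

/-- Convex functions are increasing limits of finite maxima of affine functions, so that the
convex order follows from the inequality for the latter. -/
lemma convexOrder_of_hasFirstOrderLowerBound {m : ℕ} {ε : ℝ} {w : Fin m → ℝ}
    (hw : w ∈ stdSimplex ℝ (Fin m)) {ν : Fin m → Measure (EuclideanSpace ℝ (Fin d))}
    (hν : ∀ j, ν j ∈ P2 d) {μ : Measure (EuclideanSpace ℝ (Fin d))} (hμ : μ ∈ P2 d)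
    {f : EuclideanSpace ℝ (Fin d) → ℝ} (hcont : Continuous f)
    (hf : HasFirstOrderLowerBound (barycenterFunctional ε w ν) μ f)
    (hgrad : ∀ᵐ x ∂μ, HasGradientAt f 0 x) :
    ConvexOrder μ (∑ j, ENNReal.ofReal (w j) • ν j) := by
  intro φ hφ hφν
  have := hμ.1
  have hφc : Continuous φ := continuousOn_univ.1 (hφ.continuousOn isOpen_univ)
  obtain ⟨l, c, hle, hsup⟩ := hφ.real_univ_sSup_of_nat_affine_eq hφc.lowerSemicontinuous
  set a : ℕ → EuclideanSpace ℝ (Fin d) → ℝ := fun i => ⇑(l i) + Function.const _ (c i)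
  set ψ := partialSups a with hψ
  have hint : ∀ θ ∈ P2 d, ∀ n, Integrable (ψ n) θ := fun θ hθ n => by
    have := hθ.1
    have hi : ∀ i, Integrable (a i) θ := fun i =>
      (((integrable_norm_of_mem_P2 hθ).const_mul ‖l i‖).mono'
        (l i).continuous.aestronglyMeasurable (ae_of_all _ (l i).le_opNorm)).add
        (integrable_const _)
    induction n with
    | zero => rw [hψ, partialSups_zero]; exact hi 0
    | succ n ih => rw [hψ, partialSups_add_one]; exact ih.sup (hi _)
  have hψφ : ∀ n, ψ n ≤ φ := fun n => partialSups_le _ _ _ fun i _ => hle i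
  have hbdd : BddAbove (Set.range a) := ⟨φ, Set.forall_mem_range.2 hle⟩
  have hmono : ∀ x, Monotone fun n => ψ n x := fun x i k hik => (partialSups a).monotone hik x
  have hlim : ∀ x, Tendsto (fun n => ψ n x) atTop (𝓝 (φ x)) := fun x => by
    have h1 : φ x = ⨆ n, ψ n x := by
      rw [← iSup_apply, hψ, ciSup_partialSups_eq hbdd, hsup]
    rw [h1]
    exact tendsto_atTop_ciSup (hmono x) ⟨φ x, Set.forall_mem_range.2 fun n => hψφ n x⟩
  set K := ∫ x, φ x ∂(∑ j, ENNReal.ofReal (w j) • ν j)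
  have hbound : ∀ n, ∫ x, ψ n x ∂μ ≤ K := fun n => by
    obtain ⟨g, hg, ⟨L, hL⟩, -, hsub⟩ := exists_measurable_subgradient_partialSups l c n
    have hi : ∀ j ∈ Finset.univ, Integrable (ψ n) (ENNReal.ofReal (w j) • ν j) := fun j _ =>
      (hint _ (hν j) n).smul_measure ENNReal.ofReal_ne_top
    calc ∫ x, ψ n x ∂μ ≤ ∑ j, w j * ∫ x, ψ n x ∂(ν j) :=
          integral_le_sum_of_subgradient hw hν hμ hcont hf hgrad (hint μ hμ n)
            (fun j => hint _ (hν j) n) hg hL hsub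
      _ = ∫ x, ψ n x ∂(∑ j, ENNReal.ofReal (w j) • ν j) := by
          rw [integral_finsetSum_measure hi]
          refine Finset.sum_congr rfl fun j _ => ?_
          rw [integral_smul_measure, ENNReal.toReal_ofReal (hw.1 j), smul_eq_mul]
      _ ≤ K := integral_mono (integrable_finsetSum_measure.2 hi) hφν (hψφ n)
  have hφμ : Integrable φ μ := by
    -- monotone convergence for the nonnegative functions `ψ n - ψ 0`
    have h0 : ∀ n x, 0 ≤ ψ n x - ψ 0 x := fun n x => sub_nonneg.2 (hmono x (Nat.zero_le n))
    have hd : ∀ n, Integrable (fun x => ψ n x - ψ 0 x) μ := fun n =>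
      (hint μ hμ n).sub (hint μ hμ 0)
    have h1 : Tendsto (fun n => ∫⁻ x, ENNReal.ofReal (ψ n x - ψ 0 x) ∂μ) atTop
        (𝓝 (∫⁻ x, ENNReal.ofReal (φ x - ψ 0 x) ∂μ)) :=
      lintegral_tendsto_of_tendsto_of_monotone (fun n => (hd n).aemeasurable.ennreal_ofReal)
        (ae_of_all _ fun x i k hik => ENNReal.ofReal_le_ofReal (sub_le_sub_right (hmono x hik) _))
        (ae_of_all _ fun x => ENNReal.tendsto_ofReal ((hlim x).sub_const _))
    have h2 : ∫⁻ x, ENNReal.ofReal (φ x - ψ 0 x) ∂μ ≤ ENNReal.ofReal (K - ∫ x, ψ 0 x ∂μ) :=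
      le_of_tendsto' h1 fun n => by
        rw [← ofReal_integral_eq_lintegral_ofReal (hd n) (ae_of_all _ (h0 n)),
          integral_sub (hint μ hμ n) (hint μ hμ 0)]
        exact ENNReal.ofReal_le_ofReal (sub_le_sub_right (hbound n) _)
    have h3 : Integrable (fun x => φ x - ψ 0 x) μ :=
      ⟨hφc.aestronglyMeasurable.sub (hint μ hμ 0).aestronglyMeasurable, by
        rw [hasFiniteIntegral_iff_ofReal (ae_of_all _ fun x => sub_nonneg.2 (hψφ 0 x))]
        exact h2.trans_lt ENNReal.ofReal_lt_top⟩
    exact (h3.add (hint μ hμ 0)).congr (ae_of_all _ fun x => by simp)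
  exact ⟨hφμ, le_of_tendsto' (integral_tendsto_of_tendsto_of_monotone (hint μ hμ) hφμ
    (ae_of_all _ hmono) (ae_of_all _ hlim)) hbound⟩

lemma convexOn_exp_inner_sq {E : Type*} [NormedAddCommGroup E] [InnerProductSpace ℝ E] (v : E)
    (s : ℝ) : ConvexOn ℝ Set.univ fun x : E => Real.exp ((inner ℝ x v) ^ 2 / s ^ 2) := by
  have h1 : ConvexOn ℝ Set.univ fun x : E => (inner ℝ x v) ^ 2 / s ^ 2 := by
    have h2 : ConvexOn ℝ Set.univ fun r : ℝ => (s ^ 2)⁻¹ * r ^ 2 :=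
      (even_two.convexOn_pow (𝕜 := ℝ)).smul (inv_nonneg.2 (sq_nonneg s))
    have h3 := h2.comp_linearMap (innerSL ℝ v).toLinearMap
    refine h3.congr fun x _ => ?_
    simp [real_inner_comm, div_eq_inv_mul]
  exact ⟨convex_univ, fun x hx y hy a b ha hb hab =>
    (Real.exp_le_exp.2 (h1.2 hx hy ha hb hab)).trans
      (convexOn_exp.2 (Set.mem_univ _) (Set.mem_univ _) ha hb hab)⟩

/-- The functions `x ↦ exp (⟪x, v⟫² / s²)` are convex, so that their moments decrease in the
convex order. -/
lemma ConvexOrder.mem_subgaussianMeasures {m : ℕ} {σ : ℝ≥0} {w : Fin m → ℝ}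
    (hw : w ∈ stdSimplex ℝ (Fin m)) {ν : Fin m → Measure (EuclideanSpace ℝ (Fin d))}
    (hν : ∀ j, ν j ∈ subgaussianMeasures d σ) {μ : Measure (EuclideanSpace ℝ (Fin d))}
    [IsProbabilityMeasure μ] (h : ConvexOrder μ (∑ j, ENNReal.ofReal (w j) • ν j)) :
    μ ∈ subgaussianMeasures d σ := by
  refine EntropicBarycenter.mem_subgaussianMeasures fun s hs v hv => ?_
  set φ : EuclideanSpace ℝ (Fin d) → ℝ := fun x => Real.exp ((inner ℝ x v) ^ 2 / (s : ℝ) ^ 2)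
  have hφ0 : ∀ θ : Measure (EuclideanSpace ℝ (Fin d)), 0 ≤ᵐ[θ] φ := fun θ =>
    ae_of_all _ fun x => (Real.exp_pos _).le
  have hφc : Continuous φ := by fun_prop
  have hsum : ∫⁻ x, ENNReal.ofReal (φ x) ∂(∑ j, ENNReal.ofReal (w j) • ν j) ≤ 2 := by
    rw [lintegral_finsetSum_measure]
    calc ∑ j, ∫⁻ x, ENNReal.ofReal (φ x) ∂(ENNReal.ofReal (w j) • ν j)
        ≤ ∑ j, ENNReal.ofReal (w j) * 2 := Finset.sum_le_sum fun j _ => by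
          rw [lintegral_smul_measure, smul_eq_mul]
          gcongr
          exact expSqMomentBound_of_lt (hν j) hs v hv
      _ = 2 := by
          rw [← Finset.sum_mul, ← ENNReal.ofReal_sum_of_nonneg fun j _ => hw.1 j, hw.2]
          simp
  have hint : Integrable φ (∑ j, ENNReal.ofReal (w j) • ν j) :=
    ⟨hφc.aestronglyMeasurable, by
      rw [hasFiniteIntegral_iff_ofReal (hφ0 _)]; exact hsum.trans_lt (by simp)⟩
  obtain ⟨h1, h2⟩ := h φ (convexOn_exp_inner_sq v s) hint
  calc ∫⁻ x, ENNReal.ofReal (φ x) ∂μ = ENNReal.ofReal (∫ x, φ x ∂μ) :=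
        (ofReal_integral_eq_lintegral_ofReal h1 (hφ0 _)).symm
    _ ≤ ENNReal.ofReal (∫ x, φ x ∂(∑ j, ENNReal.ofReal (w j) • ν j)) := ENNReal.ofReal_le_ofReal h2
    _ = ∫⁻ x, ENNReal.ofReal (φ x) ∂(∑ j, ENNReal.ofReal (w j) • ν j) :=
        ofReal_integral_eq_lintegral_ofReal hint (hφ0 _)
    _ ≤ 2 := hsum

end EntropicBarycenter

theorem proposition2p7 (d m : ℕ) (ε : ℝ) (hε : 0 < ε) (σ : ℝ≥0)
    (w : Fin m → ℝ) (hw : w ∈ stdSimplex ℝ (Fin m))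
    (ν : Fin m → Measure (EuclideanSpace ℝ (Fin d)))
    (hν : ∀ j, ν j ∈ EntropicBarycenter.subgaussianMeasures d σ) :
    (∀ μ : Measure (EuclideanSpace ℝ (Fin d)),
      EntropicBarycenter.IsCriticalPoint (EntropicBarycenter.barycenterFunctional ε w ν)
          (EntropicBarycenter.P2 d) μ →
        μ ∈ EntropicBarycenter.subgaussianMeasures d σ ∧
        EntropicBarycenter.ConvexOrder μ (∑ j, ENNReal.ofReal (w j) • ν j)) ∧
    (∀ μ ∈ EntropicBarycenter.P2 d,
      IsMinOn (EntropicBarycenter.barycenterFunctional ε w ν) (EntropicBarycenter.P2 d) μ →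
        μ ∈ EntropicBarycenter.subgaussianMeasures d σ) := by
  have hν2 := fun j => EntropicBarycenter.mem_P2_of_mem_subgaussianMeasures (hν j)
  refine ⟨fun μ ⟨hμ, f, hf, hgrad⟩ => ?_, fun μ hμ hmin => ?_⟩
  · have := hμ.1
    have h := EntropicBarycenter.convexOrder_of_hasFirstOrderLowerBound hw hν2 hμ hf.1
      hf.hasFirstOrderLowerBound hgrad
    exact ⟨h.mem_subgaussianMeasures hw hν, h⟩
  · have := hμ.1
    exact (EntropicBarycenter.convexOrder_of_hasFirstOrderLowerBound hw hν2 hμ continuous_zero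
      (EntropicBarycenter.hasFirstOrderLowerBound_zero_of_isMinOn hμ hmin)
      (ae_of_all _ fun x => hasGradientAt_const x (0 : ℝ))).mem_subgaussianMeasures hw hν
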